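/- Let $K$ be an infinite field, $n\ge 1$ and $r\ge 0$ integers, and let $\Sigma_r$ be the symmetric group on $r$ letters. The extended affine Weyl group $\widehat\Sigma_r=\Sigma_r\ltimes\mathbb{Z}^r$ acts on $\mathbb{Z}^r$ on the right, $\sigma\in\Sigma_r$ by place permutation and $\varepsilon\in\mathbb{Z}^r$ by $i\mapsto i+n\varepsilon$, and it acts diagonally on $\mathbb{Z}^r\times\mathbb{Z}^r$; write $\sim$ for the relation of lying in the same orbit. The affine Schur algebra $\widetilde S(n,r)$ is the $K$-algebra with a basis indexed by the orbits on $\mathbb{Z}^r\times\mathbb{Z}^r$, where $\xi_{i,j}$ denotes the basis element of the orbit of $(i,j)$, and with multiplication $$\xi_{i,j}\,\xi_{k,l}=\sum_{(p,q)\in(\mathbb{Z}^r\times\mathbb{Z}^r)/\widehat\Sigma_r}\#\{s\in\mathbb{Z}^r : (i,j)\sim(p,s),\ (s,q)\sim(k,l)\}\;\xi_{p,q}.$$ Let $i\in\{1,\dots,n\}^r$. Let $\lambda=(\lambda_1,\dots,\lambda_n)$, $\lambda_s=\#\{k : i_k=s\}$, be the weight of $i$, and let $\alpha$ be the number of nonzero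 entries of $\lambda$. Let $B_i$ be the $K$-linear span of the elements $\xi_{i,i+n\varepsilon}$, $\varepsilon\in\mathbb{Z}^r$; it is a subalgebra of the algebra $\xi_{i,i}\,\widetilde S(n,r)\,\xi_{i,i}$, whose identity is the idempotent $\xi_{i,i}$. Then $B_i$ is commutative, and it is isomorphic, as a $K$-algebra, to a polynomial algebra in $r-\alpha$ indeterminates over a Laurent polynomial algebra in $\alpha$ indeterminates over $K$. In particular, $B_i$ is Noetherian. -/

import Mathlib

namespace AffineSchur

noncomputable section

/-- The right action of the element `(σ, ε)` of the extended affine Weyl group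
`Σ_r ⋉ ℤ^r` on `I(ℤ, r)`: place permutation by `σ`, followed by the shift by `n ε`. -/
def act (n : ℕ) {r : ℕ} (σ : Equiv.Perm (Fin r)) (ε : Fin r → ℤ) (i : Fin r → ℤ) :
    Fin r → ℤ :=
  fun t => i (σ t) + n * ε t

/-- The orbit relation of the extended affine Weyl group, acting diagonally on
`I(ℤ, r) × I(ℤ, r)`. -/
def orbitSetoid (n r : ℕ) : Setoid ((Fin r → ℤ) × (Fin r → ℤ)) where
  r x y := ∃ (σ : Equiv.Perm (Fin r)) (ε : Fin r → ℤ),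
    y.1 = act n σ ε x.1 ∧ y.2 = act n σ ε x.2
  iseqv :=
    { refl := fun x => ⟨1, 0, by ext t; simp [act], by ext t; simp [act]⟩
      symm := by
        rintro x y ⟨σ, ε, h1, h2⟩
        refine ⟨σ⁻¹, fun t => - ε (σ⁻¹ t), ?_, ?_⟩
        · ext t; simp [act, h1]
        · ext t; simp [act, h2]
      trans := by
        rintro x y z ⟨σ, ε, h1, h2⟩ ⟨τ, η, h3, h4⟩
        refine ⟨σ * τ, fun t => ε (τ t) + η t, ?_, ?_⟩
        · ext t; simp [act, h1, h3]; ring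
        · ext t; simp [act, h2, h4]; ring }

/-- The set of orbits of the extended affine Weyl group on `I(ℤ, r) × I(ℤ, r)`. -/
abbrev Orb (n r : ℕ) : Type := Quotient (orbitSetoid n r)

/-- The orbit of the pair `(i, j)`. -/
def orb (n : ℕ) {r : ℕ} (i j : Fin r → ℤ) : Orb n r := Quotient.mk (orbitSetoid n r) (i, j)

theorem orb_eq_iff {n r : ℕ} {i j k l : Fin r → ℤ} :
    orb n i j = orb n k l ↔ ∃ (σ : Equiv.Perm (Fin r)) (ε : Fin r → ℤ),
      k = act n σ ε i ∧ l = act n σ ε j :=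
  Quotient.eq (r := orbitSetoid n r)

theorem orb_act {n r : ℕ} (σ : Equiv.Perm (Fin r)) (ε i j : Fin r → ℤ) :
    orb n (act n σ ε i) (act n σ ε j) = orb n i j :=
  (orb_eq_iff.2 ⟨σ, ε, rfl, rfl⟩).symm

theorem orb_out {n r : ℕ} (o : Orb n r) : orb n o.out.1 o.out.2 = o := Quotient.out_eq o

theorem act_injective {n r : ℕ} (σ : Equiv.Perm (Fin r)) (ε : Fin r → ℤ) :
    Function.Injective (act n σ ε) := by
  intro i j h
  ext t
  have := congrFun h (σ⁻¹ t)
  simpa [act] using this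

theorem act_surjective {n r : ℕ} (σ : Equiv.Perm (Fin r)) (ε : Fin r → ℤ) :
    Function.Surjective (act n σ ε) := by
  intro i
  refine ⟨fun t => i (σ⁻¹ t) - n * ε (σ⁻¹ t), ?_⟩
  ext t
  simp [act]

theorem orb_swap {n r : ℕ} {i j k l : Fin r → ℤ} (h : orb n i j = orb n k l) :
    orb n j i = orb n l k := by
  obtain ⟨σ, ε, rfl, rfl⟩ := orb_eq_iff.1 h
  exact (orb_act σ ε j i).symm

theorem finite_col {n r : ℕ} [NeZero n] (b : Orb n r) (q : Fin r → ℤ) :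
    {s : Fin r → ℤ | orb n s q = b}.Finite := by
  rw [← orb_out b]
  set k := b.out.1
  set l := b.out.2
  refine (Set.finite_range (fun σ : Equiv.Perm (Fin r) =>
    fun t => k (σ t) + n * ((q t - l (σ t)) / n))).subset ?_
  intro s hs
  obtain ⟨σ, ε, h1, h2⟩ := orb_eq_iff.1 (Eq.symm hs)
  refine ⟨σ, ?_⟩
  have hn : (n : ℤ) ≠ 0 := by exact_mod_cast NeZero.ne n
  ext t
  simp only [h1, h2, act, add_sub_cancel_left, Int.mul_ediv_cancel_left _ hn]

theorem finite_row {n r : ℕ} [NeZero n] (b : Orb n r) (q : Fin r → ℤ) :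
    {s : Fin r → ℤ | orb n q s = b}.Finite := by
  refine (finite_col (orb n b.out.2 b.out.1) q).subset ?_
  intro s hs
  exact orb_swap (Eq.trans hs (orb_out b).symm)

/-- The structure constant `Z(i, j, k, l, p, q)`, where `a`, `b`, `o` are the orbits of
`(i, j)`, `(k, l)`, `(p, q)`: the number of `s` in `I(ℤ, r)` such that `(p, s)` lies in `a`
and `(s, q)` lies in `b`. -/
def structConst {n r : ℕ} (a b o : Orb n r) : ℕ :=
  Set.ncard {s : Fin r → ℤ | orb n o.out.1 s = a ∧ orb n s o.out.2 = b}

/-- The structure constant does not depend on the representative of the third orbit. -/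
theorem structConst_orb {n r : ℕ} (a b : Orb n r) (p q : Fin r → ℤ) :
    structConst a b (orb n p q) =
      Set.ncard {s : Fin r → ℤ | orb n p s = a ∧ orb n s q = b} := by
  obtain ⟨σ, ε, h1, h2⟩ := orb_eq_iff.1 (orb_out (orb n p q)).symm
  unfold structConst
  rw [h1, h2]
  rw [← Set.ncard_image_of_injective {s | orb n p s = a ∧ orb n s q = b}
    (act_injective (n := n) σ ε)]
  congr 1
  ext s
  obtain ⟨s, rfl⟩ := act_surjective (n := n) σ ε s
  simp [orb_act, (act_injective (n := n) σ ε).eq_iff]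

theorem finite_support_structConst {n r : ℕ} [NeZero n] (a b : Orb n r) :
    {o : Orb n r | structConst a b o ≠ 0}.Finite := by
  refine ((((finite_col a a.out.2).prod (finite_row b a.out.2))).image
    (fun x => orb n x.1 x.2)).subset ?_
  intro o ho
  obtain ⟨s, hs1, hs2⟩ := Set.nonempty_of_ncard_ne_zero ho
  rw [← orb_out a] at hs1
  obtain ⟨σ, ε, h1, h2⟩ := orb_eq_iff.1 hs1
  refine ⟨(act n σ ε o.out.1, act n σ ε o.out.2), ⟨?_, ?_⟩, ?_⟩
  · change orb n _ _ = a
    rw [h2, orb_act, hs1, orb_out]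
  · change orb n _ _ = b
    rw [h2, orb_act, hs2]
  · change orb n _ _ = o
    rw [orb_act, orb_out]

/-- The underlying vector space of the affine Schur algebra: the `K`-vector space with a basis
indexed by the orbits of the extended affine Weyl group on `I(ℤ, r) × I(ℤ, r)`. -/
def Schur (K : Type*) [Field K] (n r : ℕ) : Type _ := Orb n r →₀ K

section

variable {K : Type*} [Field K] {n r : ℕ}

instance : AddCommGroup (Schur K n r) := inferInstanceAs (AddCommGroup (Orb n r →₀ K))

instance : Module K (Schur K n r) := inferInstanceAs (Module K (Orb n r →₀ K))

instance : FunLike (Schur K n r) (Orb n r) K :=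
  inferInstanceAs (FunLike (Orb n r →₀ K) (Orb n r) K)

variable (K n) in
/-- The basis element `ξ_{i,j}`. -/
def xi (i j : Fin r → ℤ) : Schur K n r := Finsupp.single (orb n i j) 1

variable (K) in
/-- The product of the basis elements indexed by the orbits `a` and `b`, given by the structure
constants. -/
def basisMul [NeZero n] (a b : Orb n r) : Schur K n r :=
  Finsupp.ofSupportFinite (fun o => (structConst a b o : K))
    ((finite_support_structConst a b).subset fun o ho h => ho (by simp [h]))

/-- The multiplication of the affine Schur algebra, the bilinear extension of `basisMul`. -/
instance [NeZero n] : Mul (Schur K n r) where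
  mul f g := Finsupp.sum (f : Orb n r →₀ K) fun a x =>
    Finsupp.sum (g : Orb n r →₀ K) fun b y => (x * y) • basisMul K a b

open Classical in
/-- The identity of the affine Schur algebra: the sum of the distinct elements `ξ_{i,i}` with
`i` in `I(n, r)`. -/
instance : One (Schur K n r) where
  one := ∑ o ∈ (Fintype.piFinset fun _ : Fin r => Finset.Icc (1 : ℤ) n).image
    (fun i => orb n i i), (Finsupp.single o 1 : Orb n r →₀ K)

theorem schur_ext {f g : Schur K n r} (h : ∀ p q, f (orb n p q) = g (orb n p q)) : f = g :=
  Finsupp.ext (f := (f : Orb n r →₀ K)) (g := g) fun o => by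
    have := h o.out.1 o.out.2
    rwa [orb_out] at this

theorem finite_col_support [NeZero n] (f : Schur K n r) (q : Fin r → ℤ) :
    {s : Fin r → ℤ | f (orb n s q) ≠ 0}.Finite := by
  have : {s : Fin r → ℤ | f (orb n s q) ≠ 0} ⊆
      ⋃ b ∈ Finsupp.support (f : Orb n r →₀ K), {s | orb n s q = b} := by
    intro s hs
    simp only [Set.mem_iUnion]
    exact ⟨orb n s q, Finsupp.mem_support_iff.2 hs, rfl⟩
  exact (Set.Finite.biUnion (Finset.finite_toSet _) fun b _ => finite_col b q).subset this

theorem add_apply (f g : Schur K n r) (o : Orb n r) : (f + g) o = f o + g o := rfl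

theorem schur_sum_apply {ι : Type*} (T : Finset ι) (F : ι → Schur K n r) (o : Orb n r) :
    (∑ x ∈ T, F x) o = ∑ x ∈ T, F x o :=
  Finsupp.finsetSum_apply T (fun x => (F x : Orb n r →₀ K)) o

theorem smul_apply (c : K) (f : Schur K n r) (o : Orb n r) : (c • f) o = c * f o := rfl

open Classical in
theorem xi_apply (i j : Fin r → ℤ) (o : Orb n r) :
    xi K n i j o = if orb n i j = o then 1 else 0 := Finsupp.single_apply

/-- The multiplication is the convolution of functions on `I(ℤ, r) × I(ℤ, r)`. -/
theorem mul_apply [NeZero n] (f g : Schur K n r) (p q : Fin r → ℤ) :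
    (f * g) (orb n p q) =
      ∑ s ∈ (finite_col_support g q).toFinset, f (orb n p s) * g (orb n s q) := by
  classical
  have key : (f * g) (orb n p q) = ∑ a ∈ Finsupp.support (f : Orb n r →₀ K),
      ∑ b ∈ Finsupp.support (g : Orb n r →₀ K),
        f a * g b * (structConst a b (orb n p q) : K) := by
    change (Finsupp.sum (f : Orb n r →₀ K) fun a x =>
      Finsupp.sum (g : Orb n r →₀ K) fun b y =>
        (x * y) • (basisMul K a b : Orb n r →₀ K)) (orb n p q) = _
    simp only [Finsupp.sum]
    rw [schur_sum_apply]
    refine Finset.sum_congr rfl fun a _ => ?_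
    rw [schur_sum_apply]
    rfl
  have key2 : ∀ a, ∀ b ∈ Finsupp.support (g : Orb n r →₀ K),
      (structConst a b (orb n p q) : K) = ∑ s ∈ (finite_col_support g q).toFinset,
        (if orb n p s = a then 1 else 0) * (if orb n s q = b then 1 else 0) := by
    intro a b hb
    rw [structConst_orb]
    simp only [← ite_and, mul_ite, mul_one, mul_zero]
    have : {s : Fin r → ℤ | orb n p s = a ∧ orb n s q = b} =
        ((finite_col_support g q).toFinset.filter
          fun s => orb n s q = b ∧ orb n p s = a : Finset _) := by
      ext s
      simp only [Set.mem_ofPred_eq, Finset.coe_filter, Set.Finite.mem_toFinset]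
      constructor
      · rintro ⟨h1, h2⟩
        exact ⟨by rw [h2]; exact Finsupp.mem_support_iff.1 hb, h2, h1⟩
      · rintro ⟨_, h1, h2⟩
        exact ⟨h2, h1⟩
    rw [this, Set.ncard_coe_finset, Finset.sum_ite, Finset.sum_const_zero, add_zero,
      Finset.sum_const, nsmul_eq_mul, mul_one]
  rw [key, Finset.sum_congr rfl fun a _ => Finset.sum_congr rfl fun b hb => by
    rw [key2 a b hb, Finset.mul_sum]]
  rw [Finset.sum_congr rfl fun a _ => Finset.sum_comm, Finset.sum_comm]
  refine Finset.sum_congr rfl fun s _ => ?_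
  have hsum : ∀ (h : Schur K n r) (o : Orb n r),
      ∑ a ∈ Finsupp.support (h : Orb n r →₀ K), h a * (if o = a then 1 else 0) = h o := by
    intro h o
    simp only [mul_ite, mul_one, mul_zero, Finset.sum_ite_eq, ite_eq_left_iff]
    exact fun ho => (Finsupp.notMem_support_iff.1 ho).symm
  rw [← hsum f (orb n p s), ← hsum g (orb n s q), Finset.sum_mul_sum]
  exact Finset.sum_congr rfl fun a _ => Finset.sum_congr rfl fun b _ => mul_mul_mul_comm _ _ _ _

/-- In `mul_apply` the sum may be taken over any finite set that is large enough. -/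
theorem mul_apply_of_subset [NeZero n] (f g : Schur K n r) (p q : Fin r → ℤ)
    (T : Finset (Fin r → ℤ)) (hT : ∀ s, f (orb n p s) * g (orb n s q) ≠ 0 → s ∈ T) :
    (f * g) (orb n p q) = ∑ s ∈ T, f (orb n p s) * g (orb n s q) := by
  classical
  rw [mul_apply]
  rw [Finset.sum_subset (Finset.subset_union_left (s₂ := T)),
    Finset.sum_subset (Finset.subset_union_right
      (s₁ := (finite_col_support g q).toFinset) (s₂ := T))]
  · intro s _ hs
    by_contra h
    exact hs (hT s h)
  · intro s _ hs
    have : g (orb n s q) = 0 := by simpa using hs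
    rw [this, mul_zero]

theorem one_apply [NeZero n] (p q : Fin r → ℤ) :
    (1 : Schur K n r) (orb n p q) = if p = q then 1 else 0 := by
  classical
  change (∑ o ∈ (Fintype.piFinset fun _ : Fin r => Finset.Icc (1 : ℤ) n).image
    (fun i => orb n i i), (Finsupp.single o 1 : Orb n r →₀ K)) (orb n p q) = _
  simp only [Finsupp.finsetSum_apply, Finsupp.single_apply, Finset.sum_ite_eq']
  refine if_congr ?_ rfl rfl
  simp only [Finset.mem_image, Fintype.mem_piFinset, Finset.mem_Icc]
  constructor
  · rintro ⟨i, _, h⟩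
    obtain ⟨σ, ε, rfl, rfl⟩ := orb_eq_iff.1 h
    rfl
  · rintro rfl
    have hn : (0 : ℤ) < n := by exact_mod_cast Nat.pos_of_ne_zero (NeZero.ne n)
    refine ⟨fun t => (p t - 1) % n + 1, fun t => ⟨?_, ?_⟩, orb_eq_iff.2
      ⟨1, fun t => (p t - 1) / n, ?_⟩⟩
    · have := Int.emod_nonneg (p t - 1) hn.ne'
      linarith
    · have := Int.emod_lt_of_pos (p t - 1) hn
      exact this
    · have : p = act n 1 (fun t => (p t - 1) / n) fun t => (p t - 1) % n + 1 := by
        ext t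
        have := Int.emod_add_mul_ediv (p t - 1) n
        simp only [act, Equiv.Perm.one_apply]
        omega
      exact ⟨this, this⟩

theorem schur_one_mul [NeZero n] (f : Schur K n r) : 1 * f = f := by
  classical
  refine schur_ext fun p q => ?_
  rw [mul_apply_of_subset 1 f p q {p}]
  · simp [one_apply]
  · intro s hs
    by_contra h
    exact hs (by rw [one_apply, if_neg fun h' => h (by simp [h']), zero_mul])

theorem schur_mul_one [NeZero n] (f : Schur K n r) : f * 1 = f := by
  classical
  refine schur_ext fun p q => ?_
  rw [mul_apply_of_subset f 1 p q {q}]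
  · simp [one_apply]
  · intro s hs
    by_contra h
    exact hs (by rw [one_apply, if_neg fun h' => h (by simp [h']), mul_zero])

theorem schur_mul_assoc [NeZero n] (f g h : Schur K n r) : f * g * h = f * (g * h) := by
  classical
  refine schur_ext fun p q => ?_
  set U := (finite_col_support h q).toFinset
  set T := U.biUnion fun u => (finite_col_support g u).toFinset
  rw [mul_apply_of_subset (f * g) h p q U, mul_apply_of_subset f (g * h) p q T]
  · have h1 : ∀ u ∈ U, (f * g) (orb n p u) * h (orb n u q) =
        ∑ s ∈ T, f (orb n p s) * g (orb n s u) * h (orb n u q) := by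
      intro u hu
      rw [mul_apply_of_subset f g p u T, Finset.sum_mul]
      intro s hs
      exact Finset.mem_biUnion.2 ⟨u, hu, by simpa using right_ne_zero_of_mul hs⟩
    have h2 : ∀ s ∈ T, f (orb n p s) * (g * h) (orb n s q) =
        ∑ u ∈ U, f (orb n p s) * g (orb n s u) * h (orb n u q) := by
      intro s _
      rw [mul_apply, Finset.mul_sum]
      exact Finset.sum_congr rfl fun u _ => (mul_assoc _ _ _).symm
    rw [Finset.sum_congr rfl h1, Finset.sum_congr rfl h2, Finset.sum_comm]
  · intro s hs
    have hs' := right_ne_zero_of_mul hs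
    rw [mul_apply] at hs'
    obtain ⟨u, hu, hu'⟩ := Finset.exists_ne_zero_of_sum_ne_zero hs'
    exact Finset.mem_biUnion.2 ⟨u, hu, by simpa using left_ne_zero_of_mul hu'⟩
  · intro u hu
    have := right_ne_zero_of_mul hu
    simpa [U] using this

theorem schur_mul_add [NeZero n] (f g h : Schur K n r) : f * (g + h) = f * g + f * h := by
  classical
  refine schur_ext fun p q => ?_
  set T := (finite_col_support g q).toFinset ∪ (finite_col_support h q).toFinset with hT
  rw [add_apply, mul_apply_of_subset f (g + h) p q T, mul_apply_of_subset f g p q T,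
    mul_apply_of_subset f h p q T, ← Finset.sum_add_distrib]
  · exact Finset.sum_congr rfl fun s _ => by rw [add_apply, mul_add]
  · intro s hs
    simp [hT, right_ne_zero_of_mul hs]
  · intro s hs
    simp [hT, right_ne_zero_of_mul hs]
  · intro s hs
    by_contra hs'
    simp only [hT, Finset.mem_union, Set.Finite.mem_toFinset, Set.mem_ofPred_eq, not_or,
      not_not] at hs'
    exact hs (by rw [add_apply, hs'.1, hs'.2]; simp)

theorem schur_add_mul [NeZero n] (f g h : Schur K n r) : (f + g) * h = f * h + g * h := by
  refine schur_ext fun p q => ?_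
  simp only [add_apply, mul_apply, add_mul, Finset.sum_add_distrib]

theorem schur_smul_mul [NeZero n] (c : K) (f g : Schur K n r) : c • f * g = c • (f * g) := by
  refine schur_ext fun p q => ?_
  simp only [smul_apply, mul_apply, mul_assoc, Finset.mul_sum]

theorem schur_mul_smul [NeZero n] (c : K) (f g : Schur K n r) : f * c • g = c • (f * g) := by
  refine schur_ext fun p q => ?_
  rw [mul_apply_of_subset f (c • g) p q (finite_col_support g q).toFinset, smul_apply,
    mul_apply, Finset.mul_sum]
  · exact Finset.sum_congr rfl fun s _ => by rw [smul_apply]; ring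
  · intro s hs
    rw [smul_apply] at hs
    have := right_ne_zero_of_mul (right_ne_zero_of_mul hs)
    simpa using this

instance [NeZero n] : Ring (Schur K n r) where
  __ := (inferInstance : AddCommGroup (Schur K n r))
  mul_assoc := schur_mul_assoc
  one_mul := schur_one_mul
  mul_one := schur_mul_one
  left_distrib := schur_mul_add
  right_distrib := schur_add_mul
  zero_mul f := by simpa using schur_smul_mul (0 : K) 0 f
  mul_zero f := by simpa using schur_mul_smul (0 : K) f 0

/-- The affine Schur algebra as a `K`-algebra. -/
instance [NeZero n] : Algebra K (Schur K n r) :=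
  Algebra.ofModule schur_smul_mul schur_mul_smul

theorem xi_self_mul [NeZero n] (i j : Fin r → ℤ) : xi K n i i * xi K n i j = xi K n i j := by
  classical
  refine schur_ext fun p q => ?_
  rw [mul_apply_of_subset _ _ p q {p}]
  · rw [Finset.sum_singleton, xi_apply, xi_apply]
    by_cases h : orb n i j = orb n p q
    · obtain ⟨σ, ε, rfl, rfl⟩ := orb_eq_iff.1 h
      simp [orb_act]
    · simp [h]
  · intro s hs
    have h1 := left_ne_zero_of_mul hs
    rw [xi_apply] at h1
    obtain ⟨σ, ε, rfl, rfl⟩ := orb_eq_iff.1 (by_contra fun h => h1 (if_neg h))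
    simp

theorem xi_mul_self [NeZero n] (i j : Fin r → ℤ) : xi K n i j * xi K n j j = xi K n i j := by
  classical
  refine schur_ext fun p q => ?_
  rw [mul_apply_of_subset _ _ p q {q}]
  · rw [Finset.sum_singleton, xi_apply, xi_apply]
    by_cases h : orb n i j = orb n p q
    · obtain ⟨σ, ε, rfl, rfl⟩ := orb_eq_iff.1 h
      simp [orb_act]
    · simp [h]
  · intro s hs
    have h1 := right_ne_zero_of_mul hs
    rw [xi_apply] at h1
    obtain ⟨σ, ε, rfl, rfl⟩ := orb_eq_iff.1 (by_contra fun h => h1 (if_neg h))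
    simp

end

/-- The corner `e A e` of a `K`-algebra `A` at an idempotent `e` is a `K`-submodule of `A`. -/
def cornerSubmodule (K : Type*) {A : Type*} [Field K] [Ring A] [Algebra K A] (e : A) :
    Submodule K A where
  carrier := NonUnitalRing.corner e
  add_mem' := add_mem
  zero_mem' := zero_mem _
  smul_mem' := by
    rintro c _ ⟨a, rfl⟩
    exact ⟨c • a, by simp⟩

/-- The `K`-module structure of the corner `e A e`. -/
abbrev cornerModule {K A : Type*} [Field K] [Ring A] [Algebra K A] {e : A}
    (he : IsIdempotentElem e) : Module K he.Corner where
  smul c x := ⟨c • x.1, (cornerSubmodule K e).smul_mem c x.2⟩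
  one_smul x := Subtype.ext (one_smul K x.1)
  mul_smul c d x := Subtype.ext (mul_smul c d x.1)
  smul_zero c := Subtype.ext (smul_zero c)
  smul_add c x y := Subtype.ext (smul_add c x.1 y.1)
  add_smul c d x := Subtype.ext (add_smul c d x.1)
  zero_smul x := Subtype.ext (zero_smul K x.1)

/-- The corner `e A e` of a `K`-algebra `A` at an idempotent `e` is a `K`-algebra with
identity `e`. -/
instance {K A : Type*} [Field K] [Ring A] [Algebra K A] {e : A} (he : IsIdempotentElem e) :
    Algebra K he.Corner :=
  letI := cornerModule (K := K) he
  Algebra.ofModule (fun c x y => Subtype.ext (smul_mul_assoc c x.1 y.1))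
    (fun c x y => Subtype.ext (mul_smul_comm c x.1 y.1))

section

variable (K : Type*) [Field K] (n : ℕ) [NeZero n] {r : ℕ} (i : Fin r → ℤ)

theorem xi_idem : IsIdempotentElem (xi K n i i) := xi_self_mul i i

/-- The centralizer algebra `ξ_{i,i} S ξ_{i,i}` of the affine Schur algebra `S`, a `K`-algebra
with identity `ξ_{i,i}`. -/
abbrev Centralizer : Type _ := (xi_idem K n i).Corner

/-- The element `ξ_{i, i + nε}`, as an element of the centralizer algebra. -/
def xiShift (ε : Fin r → ℤ) : Centralizer K n i :=
  ⟨xi K n i (fun t => i t + n * ε t), by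
    refine (Subsemigroup.mem_corner_iff (xi_idem K n i)).2 ⟨xi_self_mul _ _, ?_⟩
    have : xi K n i i = xi K n (fun t => i t + n * ε t) (fun t => i t + n * ε t) := by
      unfold xi
      rw [← orb_act 1 ε i i]
      rfl
    rw [this]
    exact xi_mul_self _ _⟩

theorem xiShift_zero : xiShift K n i 0 = 1 := by
  refine Subtype.ext ?_
  change xi K n i _ = xi K n i i
  simp

theorem xiShift_mul_mem (ε ε' : Fin r → ℤ) :
    xiShift K n i ε * xiShift K n i ε' ∈ Submodule.span K (Set.range (xiShift K n i)) := by
  classical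
  set f := xi K n i (fun t => i t + n * ε t) * xi K n i (fun t => i t + n * ε' t) with hf
  have hsupp : ∀ o : Orb n r, f o ≠ 0 → ∃ η : Fin r → ℤ, o = orb n i (fun t => i t + n * η t) := by
    intro o ho
    rw [← orb_out o, hf, mul_apply] at ho
    obtain ⟨s, _, hs⟩ := Finset.exists_ne_zero_of_sum_ne_zero ho
    have h1 := left_ne_zero_of_mul hs
    have h2 := right_ne_zero_of_mul hs
    rw [xi_apply] at h1 h2
    obtain ⟨σ, η, h3, h4⟩ := orb_eq_iff.1 (by_contra fun h => h1 (if_neg h))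
    obtain ⟨τ, θ, h5, h6⟩ := orb_eq_iff.1 (by_contra fun h => h2 (if_neg h))
    refine ⟨fun t => ε t + ε' (τ (σ⁻¹ t)), ?_⟩
    rw [← orb_out o]
    refine (orb_eq_iff.2 ⟨σ, η, h3, ?_⟩).symm
    ext t
    have h7 := congrFun h6 t
    have h8 := congrFun h5 t
    rw [h4] at h8
    simp only [act] at h7 h8
    simp only [act, Equiv.Perm.inv_def, Equiv.symm_apply_apply]
    rw [h7]
    linarith
  have hmem : f ∈ Submodule.span K (Set.range fun ε => (xiShift K n i ε).1) := by
    have : f = ∑ o ∈ Finsupp.support (f : Orb n r →₀ K),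
        f o • (Finsupp.single o 1 : Orb n r →₀ K) := by
      conv_lhs => rw [← Finsupp.sum_single (f : Orb n r →₀ K)]
      unfold Finsupp.sum
      refine Finset.sum_congr rfl fun o _ => ?_
      rw [Finsupp.smul_single, smul_eq_mul, mul_one]
      rfl
    rw [this]
    refine Submodule.sum_mem _ fun o ho => Submodule.smul_mem _ _ (Submodule.subset_span ?_)
    obtain ⟨η, rfl⟩ := hsupp o (Finsupp.mem_support_iff.1 ho)
    exact ⟨η, rfl⟩
  let ι : Centralizer K n i →ₗ[K] Schur K n r :=
    { toFun := Subtype.val, map_add' := fun _ _ => rfl, map_smul' := fun _ _ => rfl }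
  have h9 : Submodule.map ι (Submodule.span K (Set.range (xiShift K n i))) =
      Submodule.span K (Set.range fun ε => (xiShift K n i ε).1) := by
    rw [Submodule.map_span, ← Set.range_comp]
    rfl
  rw [← h9] at hmem
  obtain ⟨x, hx, hxf⟩ := hmem
  have : x = xiShift K n i ε * xiShift K n i ε' := Subtype.ext hxf
  rwa [← this]

/-- The subalgebra `B_i = span {ξ_{i, i + nε} | ε ∈ ℤ^r}` of the centralizer algebra. -/
def B : Subalgebra K (Centralizer K n i) :=
  (Submodule.span K (Set.range (xiShift K n i))).toSubalgebra
    (Submodule.subset_span ⟨0, xiShift_zero K n i⟩) (by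
      intro x y hx hy
      have h := Submodule.mul_mem_mul hx hy
      rw [Submodule.span_mul_span] at h
      refine Submodule.span_le.2 ?_ h
      rintro _ ⟨_, ⟨ε, rfl⟩, _, ⟨ε', rfl⟩, rfl⟩
      exact xiShift_mul_mem K n i ε ε')

end

/-- The weight of `i`: its entry at `s` is the number of places at which `i` takes the
value `s`. -/
def weight {r : ℕ} (i : Fin r → ℤ) (s : ℤ) : ℕ :=
  (Finset.univ.filter fun k => i k = s).card

/-- The number of nonzero entries of the weight `(λ_1, …, λ_n)` of `i`. -/
def numNonzero (n : ℕ) {r : ℕ} (i : Fin r → ℤ) : ℕ :=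
  ((Finset.Icc (1 : ℤ) n).filter fun s => weight i s ≠ 0).card

/-- The algebra of Laurent polynomials over `K` in `m` indeterminates: the group algebra of
the free abelian group of rank `m`. -/
abbrev LaurentAlgebra (K : Type*) [Field K] (m : ℕ) : Type _ := AddMonoidAlgebra K (Fin m → ℤ)

end

end AffineSchur

/-! Record an element `x` of `B K n i` by the Laurent polynomial in `r` variables whose coefficient
at `ε` is the value of `x` at the orbit of `(i, i + nε)`. The product of the Schur algebra is a
convolution over intermediate indices `s`. For a left factor in `B K n i` only `s = i + nη`
contributes, and translation carries `(i + nη, i + nε)` to `(i, i + n(ε - η))`, so the product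
becomes the convolution on `ℤ^r`. This gives an injective algebra homomorphism, `laurentEmbedding`.

The entries of `i` lie in `1, …, n`, so the pairs for `ε` and `η` share an orbit exactly when `η = ε
∘ π` for some `π` fixing `i` (`orb_shift_eq_iff`). The image is therefore the ring of Laurent
polynomials invariant under the Young subgroup that permutes the places within each block on which
`i` is constant (`exists_laurentEmbedding_eq_iff`).

The fundamental theorem on symmetric polynomials, applied block by block (`elemHom_injective`,
`exists_elemHom_eq`), makes the invariant polynomials free on the elementary symmetric polynomials
of the blocks. Passing to Laurent polynomials inverts only the top one of each block, the product of
its variables (`exists_laurentHom_eq_iff`, `laurentHom_injective`). The `α` blocks thus give `α`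
Laurent indeterminates and leave `r - α` polynomial ones. Commutativity and the Noetherian property
follow from the isomorphism. -/

namespace BlockSymmetric

/-! ### Symmetric polynomials for a Young subgroup, by lexicographic leading terms. -/

open MvPolynomial MonomialOrder

noncomputable section

variable {σ A : Type*}

/-- The exponent of the squarefree monomial `∏ u ∈ S, X u`. -/
def ind (S : Finset σ) : σ →₀ ℕ := ∑ u ∈ S, Finsupp.single u 1

theorem ind_apply [DecidableEq σ] (S : Finset σ) (u : σ) : ind S u = if u ∈ S then 1 else 0 := by
  simp [ind, Finsupp.finsetSum_apply, Finsupp.single_apply]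

/-- The block of `t`: the elements of the same color under `b`. -/
def block [Fintype σ] [DecidableEq A] (b : σ → A) (t : σ) : Finset σ :=
  Finset.univ.filter fun u => b u = b t

theorem mem_block [Fintype σ] [DecidableEq A] {b : σ → A} {t u : σ} : u ∈ block b t ↔ b u = b t := by
  simp [block]

variable {K : Type*} [Field K] {b : σ → A} [Fintype σ] [LinearOrder σ]

/-- The leading exponents of block-symmetric polynomials decrease along each block. -/
theorem degree_antitone {f : MvPolynomial σ K}
    (hf : ∀ π : Equiv.Perm σ, b ∘ π = b → rename π f = f) {u v : σ} (huv : u < v)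
    (hb : b u = b v) : lex.degree f v ≤ lex.degree f u := by
  by_cases hf0 : f = 0
  · simp [hf0]
  by_contra! hlt
  have hπ : b ∘ Equiv.swap u v = b := by
    ext x
    simp only [Function.comp_apply, Equiv.swap_apply_def]
    split_ifs with h1 h2
    · rw [h1, hb]
    · rw [h2, hb]
    · rfl
  set d := lex.degree f
  -- Invariance puts the swapped exponent in the support as well. It is lexicographically larger
  -- than `d` if `d u < d v`, since smaller indices are more significant.
  have hd : d.mapDomain (Equiv.swap u v) ∈ f.support := by
    rw [mem_support_iff]
    conv_lhs => rw [← hf _ hπ]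
    rw [coeff_rename_mapDomain _ (Equiv.swap u v).injective, coeff_degree_ne_zero_iff]
    exact hf0
  refine (le_degree (m := lex) hd).not_gt ?_
  have happ : ∀ x, d.mapDomain (Equiv.swap u v) x = d (Equiv.swap u v x) := fun x => by
    conv_lhs => rw [← Equiv.swap_apply_self u v x]
    rw [Finsupp.mapDomain_apply (Equiv.swap u v).injective]
  rw [lex_lt_iff, Finsupp.Lex.lt_iff]
  refine ⟨u, fun k hk => ?_, ?_⟩
  · simp only [ofLex_toLex]
    rw [happ, Equiv.swap_apply_of_ne_of_ne hk.ne (hk.trans huv).ne]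
  · simp only [ofLex_toLex]
    rwa [happ, Equiv.swap_apply_left]

variable [DecidableEq A]

/-- The part of the block of `t` up to `t`. -/
def initialPart (b : σ → A) (t : σ) : Finset σ := (block b t).filter fun u => u ≤ t

theorem mem_initialPart {t u : σ} : u ∈ initialPart b t ↔ b u = b t ∧ u ≤ t := by
  simp [initialPart, mem_block]

variable (K b) in
/-- The elementary symmetric polynomial in the variables of the block of `t` whose degree is the
rank of `t` in its block. -/
def elem (t : σ) : MvPolynomial σ K :=
  ∑ S ∈ (block b t).powersetCard (initialPart b t).card, monomial (ind S) 1

theorem rename_elem (π : Equiv.Perm σ) (hπ : b ∘ π = b) (t : σ) :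
    rename π (elem K b t) = elem K b t := by
  have hb : (block b t).map π.toEmbedding = block b t := by
    ext u
    simp only [Finset.mem_map_equiv, mem_block]
    rw [← congrFun hπ (π.symm u)]
    simp
  conv_rhs => rw [elem, ← hb, Finset.powersetCard_map, Finset.sum_map]
  rw [elem, map_sum]
  refine Finset.sum_congr rfl fun S _ => ?_
  rw [rename_monomial]
  congr 1
  simp [ind, Finsupp.mapDomain_finsetSum, Finsupp.mapDomain_single]

/-- At the least element `j` of the initial part missing from `S`, the exponent of `S` is smaller.
Below `j` the two sets agree, because elements of the block below `j` belong to the initial part. -/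
theorem ind_lt {t : σ} {S : Finset σ} (hS : S ∈ (block b t).powersetCard (initialPart b t).card)
    (hne : S ≠ initialPart b t) : ind S ≺[lex] ind (initialPart b t) := by
  rw [Finset.mem_powersetCard] at hS
  have hsd : (initialPart b t \ S).Nonempty := by
    rw [Finset.sdiff_nonempty]
    exact fun h => hne (Finset.eq_of_subset_of_card_le h hS.2.le).symm
  rw [lex_lt_iff, Finsupp.Lex.lt_iff]
  have hj := Finset.min'_mem _ hsd
  set j := (initialPart b t \ S).min' hsd
  rw [Finset.mem_sdiff] at hj
  refine ⟨j, fun k hk => ?_, ?_⟩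
  · simp only [ofLex_toLex, ind_apply]
    refine if_congr ⟨fun h => ?_, fun h => ?_⟩ rfl rfl
    · exact mem_initialPart.2 ⟨mem_block.1 (hS.1 h), hk.le.trans (mem_initialPart.1 hj.1).2⟩
    · by_contra hkS
      exact (Finset.min'_le _ k (Finset.mem_sdiff.2 ⟨h, hkS⟩)).not_gt hk
  · simp [ind_apply, hj.1, hj.2]

theorem elem_eq (t : σ) : ∃ g : MvPolynomial σ K,
    elem K b t = monomial (ind (initialPart b t)) 1 + g ∧
      (g = 0 ∨ lex.degree g ≺[lex] ind (initialPart b t)) := by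
  have hmem : initialPart b t ∈ (block b t).powersetCard (initialPart b t).card :=
    Finset.mem_powersetCard.2 ⟨Finset.filter_subset _ _, rfl⟩
  refine ⟨_, (Finset.add_sum_erase _ _ hmem).symm, or_iff_not_imp_left.2 fun hg => ?_⟩
  have := degree_mem_support (m := lex) hg
  obtain ⟨S, hS, h⟩ := Finset.mem_biUnion.1 (support_sum this)
  rw [Finset.mem_erase] at hS
  rw [Finset.mem_singleton.1 (support_monomial_subset h)]
  exact ind_lt hS.2 hS.1

theorem degree_elem (t : σ) : lex.degree (elem K b t) = ind (initialPart b t) := by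
  classical
  obtain ⟨g, hg, rfl | h⟩ := elem_eq (K := K) (b := b) t
  · rw [hg, add_zero, degree_monomial, if_neg one_ne_zero]
  · rw [hg, degree_add_of_lt, degree_monomial, if_neg one_ne_zero]
    rwa [degree_monomial, if_neg one_ne_zero]

theorem monic_elem (t : σ) : lex.Monic (elem K b t) := by
  classical
  obtain ⟨g, hg, rfl | h⟩ := elem_eq (K := K) (b := b) t
  · rw [hg, add_zero]
    exact monic_monomial_one
  · rw [hg]
    refine monic_monomial_one.add_of_lt ?_
    rwa [degree_monomial, if_neg one_ne_zero]

/-- Being a single monomial, this generator becomes a unit among Laurent polynomials. It is the one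
that gets inverted. -/
theorem elem_of_isTop {t : σ} (ht : ∀ u, b u = b t → u ≤ t) :
    elem K b t = monomial (ind (block b t)) 1 := by
  have : initialPart b t = block b t := by
    ext u
    simp only [mem_initialPart, mem_block]
    exact ⟨And.left, fun h => ⟨h, ht u h⟩⟩
  rw [elem, this, Finset.powersetCard_self, Finset.sum_singleton]

variable (K b) in
/-- The evaluation of polynomials at the block-wise elementary symmetric polynomials. -/
def elemHom : MvPolynomial σ K →ₐ[K] MvPolynomial σ K := aeval (elem K b)

theorem rename_elemHom (π : Equiv.Perm σ) (hπ : b ∘ π = b) (p : MvPolynomial σ K) :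
    rename π (elemHom K b p) = elemHom K b p := by
  have : (rename π).comp (elemHom K b) = elemHom K b := by
    ext1 t
    simp [elemHom, rename_elem π hπ]
  exact DFunLike.congr_fun this p

/-- The leading exponent of the image of a monomial under `elemHom`. -/
def leadingExp (b : σ → A) (c : σ →₀ ℕ) : σ →₀ ℕ := ∑ t, c t • ind (initialPart b t)

theorem elemHom_monomial (c : σ →₀ ℕ) :
    elemHom K b (monomial c 1) = ∏ t, elem K b t ^ c t := by
  rw [elemHom, aeval_monomial, map_one, one_mul, Finsupp.prod_fintype]
  simp

theorem degree_elemHom_monomial (c : σ →₀ ℕ) :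
    lex.degree (elemHom K b (monomial c 1)) = leadingExp b c := by
  rw [elemHom_monomial, degree_prod fun t _ => pow_ne_zero _ (monic_elem t).ne_zero]
  simp [degree_pow, degree_elem, leadingExp]

theorem monic_elemHom_monomial (c : σ →₀ ℕ) : lex.Monic (elemHom K b (monomial c 1)) := by
  rw [elemHom_monomial]
  exact Monic.prod fun t _ => (monic_elem t).pow

theorem leadingExp_apply (c : σ →₀ ℕ) (u : σ) :
    leadingExp b c u = c u + ∑ t ∈ Finset.univ.filter (fun t => b u = b t ∧ u < t), c t := by
  have h : leadingExp b c u = ∑ t ∈ Finset.univ.filter (fun t => b u = b t ∧ u ≤ t), c t := by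
    simp [leadingExp, Finsupp.finsetSum_apply, ind_apply, mem_initialPart, Finset.sum_filter]
  rw [h, ← Finset.add_sum_erase _ _ (a := u) (by simp)]
  congr 2
  ext t
  simp only [Finset.mem_erase, Finset.mem_filter, Finset.mem_univ, true_and, lt_iff_le_and_ne]
  tauto

/-- By `leadingExp_apply` the map is unitriangular, so `c` is recovered from the largest index
downwards. -/
theorem leadingExp_injective : Function.Injective (leadingExp b) := by
  intro c d h
  ext u
  induction u using WellFoundedGT.induction with
  | ind u ih =>
    have hu := DFunLike.congr_fun h u
    rw [leadingExp_apply, leadingExp_apply, Finset.sum_congr rfl fun t ht =>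
      ih t (Finset.mem_filter.1 ht).2.2] at hu
    exact Nat.add_right_cancel hu

theorem elemHom_injective : Function.Injective (elemHom K b) := by
  rw [injective_iff_map_eq_zero]
  intro p hp
  by_contra hne
  -- Distinct monomials have images with distinct leading exponents, so the largest of these cannot
  -- cancel.
  obtain ⟨c, hc, hmax⟩ := p.support.exists_max_image (fun c => lex.toSyn (leadingExp b c))
    (Finset.nonempty_iff_ne_empty.2 fun h => hne (support_eq_empty.1 h))
  have key : (elemHom K b p).coeff (leadingExp b c) = p.coeff c := by
    conv_lhs => rw [p.as_sum, map_sum, coeff_sum]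
    rw [Finset.sum_eq_single_of_mem c hc]
    · rw [← mul_one (coeff c p), ← smul_eq_mul, ← smul_monomial, map_smul, coeff_smul,
        ← degree_elemHom_monomial (K := K), (monic_elemHom_monomial c).coeff_degree]
    · intro d hd hdc
      rw [← mul_one (coeff d p), ← smul_eq_mul, ← smul_monomial, map_smul, coeff_smul,
        smul_eq_mul, coeff_eq_zero_of_lt (m := lex) (f := elemHom K b (monomial d 1)), mul_zero]
      rw [degree_elemHom_monomial]
      exact lt_of_le_of_ne (hmax d hd) fun h => hdc (leadingExp_injective (lex.toSyn.injective h))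
  rw [hp, coeff_zero] at key
  exact mem_support_iff.1 hc key.symm

/-- An exponent decreasing along each block is a sum of indicators of initial parts, as a partition
is the sum of its columns. One indicator is split off at a time, by induction on the total degree.
-/
theorem exists_leadingExp_eq (μ : σ →₀ ℕ) (hμ : ∀ u v, u < v → b u = b v → μ v ≤ μ u) :
    ∃ c, leadingExp b c = μ := by
  obtain ⟨N, hN⟩ : ∃ N, μ.degree = N := ⟨_, rfl⟩
  induction N using Nat.strong_induction_on generalizing μ with
  | _ N ih =>
  by_cases h0 : μ = 0
  · exact ⟨0, by simp [h0, leadingExp]⟩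
  have hne : μ.support.Nonempty := Finsupp.support_nonempty_iff.2 h0
  -- Since `t` is the last index in the support, `μ` is positive on the whole initial part of `t`
  -- and zero beyond it, so removing the indicator keeps the exponent decreasing.
  obtain ⟨t, ht, hmax⟩ : ∃ t, μ t ≠ 0 ∧ ∀ u, μ u ≠ 0 → u ≤ t :=
    ⟨μ.support.max' hne, Finsupp.mem_support_iff.1 (Finset.max'_mem _ hne),
      fun u hu => Finset.le_max' _ _ (Finsupp.mem_support_iff.2 hu)⟩
  have hle : ind (initialPart b t) ≤ μ := by
    intro u
    rw [ind_apply]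
    split_ifs with hu
    · rw [mem_initialPart] at hu
      rcases hu.2.eq_or_lt with rfl | hlt
      · exact Nat.one_le_iff_ne_zero.2 ht
      · exact (Nat.one_le_iff_ne_zero.2 ht).trans (hμ u t hlt hu.1)
    · exact Nat.zero_le _
  obtain ⟨ν, rfl⟩ := exists_add_of_le hle
  obtain ⟨c, hc⟩ := ih ν.degree (by
    have h1 : (ind (initialPart b t)).degree ≠ 0 := by
      rw [ne_eq, Finsupp.degree_eq_zero_iff]
      intro h
      have := DFunLike.congr_fun h t
      simp [ind_apply, mem_initialPart] at this
    rw [← hN, map_add]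
    omega) ν (fun u v huv hb => by
      have h1 := hμ u v huv hb
      have h2 := hmax v
      simp only [Finsupp.add_apply, ind_apply, mem_initialPart] at h1 h2
      rw [hb] at h1
      by_cases hbt : b v = b t
      · by_cases hv : v ≤ t
        · simpa [hbt, hv, huv.le.trans hv] using h1
        · have h3 := not_imp_not.2 h2 hv
          omega
      · simpa [hbt] using h1) rfl
  refine ⟨Finsupp.single t 1 + c, ?_⟩
  rw [← hc]
  simp [leadingExp, add_smul, Finset.sum_add_distrib, Finsupp.single_apply]

/-- The fundamental theorem on symmetric polynomials for a Young subgroup. -/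
theorem exists_elemHom_eq (f : MvPolynomial σ K)
    (hf : ∀ π : Equiv.Perm σ, b ∘ π = b → rename π f = f) : ∃ p, elemHom K b p = f := by
  obtain ⟨N, hN⟩ : ∃ N, lex.toSyn (lex.degree f) = N := ⟨_, rfl⟩
  revert f
  induction N using WellFoundedLT.induction with
  | ind N ih =>
  intro f hf hN
  by_cases hf0 : f = 0
  · exact ⟨0, by simp [hf0]⟩
  obtain ⟨c, hc⟩ := exists_leadingExp_eq (b := b) (lex.degree f) fun u v => degree_antitone hf
  set g := f - elemHom K b (monomial c (lex.leadingCoeff f)) with hg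
  have hinv : ∀ π : Equiv.Perm σ, b ∘ π = b → rename π g = g := fun π hπ => by
    rw [hg, map_sub, hf π hπ, rename_elemHom π hπ]
  by_cases hg0 : g = 0
  · exact ⟨_, (sub_eq_zero.1 hg0).symm⟩
  have hmon : elemHom K b (monomial c (lex.leadingCoeff f)) =
      lex.leadingCoeff f • elemHom K b (monomial c 1) := by
    rw [← map_smul, smul_monomial, smul_eq_mul, mul_one]
  have hle : lex.degree g ≼[lex] lex.degree f := by
    refine degree_sub_le.trans (sup_le le_rfl ?_)
    rw [hmon]
    refine degree_smul_le.trans ?_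
    rw [degree_elemHom_monomial, hc]
  -- The subtracted image has the same leading exponent and coefficient as `f`, so the leading terms
  -- cancel.
  have hlt : lex.degree g ≺[lex] lex.degree f := by
    refine lt_of_le_of_ne hle fun h => ?_
    have h1 := (coeff_degree_ne_zero_iff (m := lex)).2 hg0
    rw [lex.toSyn.injective h, hg, coeff_sub, hmon, coeff_smul, ← hc,
      ← degree_elemHom_monomial (K := K), (monic_elemHom_monomial c).coeff_degree,
      degree_elemHom_monomial, hc] at h1
    exact h1 (by simp [leadingCoeff])
  obtain ⟨p, hp⟩ := ih _ (by rwa [← hN]) g hinv rfl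
  exact ⟨p + monomial c (lex.leadingCoeff f), by rw [map_add, hp, hg, sub_add_cancel]⟩

end

end BlockSymmetric

namespace BlockSymmetric

open MvPolynomial

noncomputable section

/-! ### Laurent polynomials and clearing denominators. -/

section Laurent

variable {σ A : Type*} {K : Type*} [Field K]

theorem comp_symm_eq {b : σ → A} {π : Equiv.Perm σ} (hπ : b ∘ π = b) : b ∘ π.symm = b := by
  ext u
  simpa using (congrFun hπ (π.symm u)).symm

/-- The inclusion of natural exponents into integral exponents. -/
def natExp (σ : Type*) : (σ →₀ ℕ) →+ (σ → ℤ) where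
  toFun c t := c t
  map_zero' := by ext; simp
  map_add' c d := by ext; simp

theorem natExp_apply (c : σ →₀ ℕ) (t : σ) : natExp σ c t = c t := rfl

theorem natExp_injective : Function.Injective (natExp σ) := by
  intro c d h
  ext t
  exact Nat.cast_injective (congrFun h t)

variable (K) in
/-- The inclusion of the polynomial algebra into the Laurent polynomial algebra. -/
def toLaurent : MvPolynomial σ K →ₐ[K] AddMonoidAlgebra K (σ → ℤ) :=
  AddMonoidAlgebra.mapDomainAlgHom K K (natExp σ)

theorem toLaurent_monomial (c : σ →₀ ℕ) (k : K) :
    toLaurent K (monomial c k) = AddMonoidAlgebra.single (natExp σ c) k :=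
  AddMonoidAlgebra.mapDomain_single

theorem toLaurent_injective :
    Function.Injective (toLaurent K : MvPolynomial σ K → AddMonoidAlgebra K (σ → ℤ)) :=
  AddMonoidAlgebra.mapDomain_injective natExp_injective

theorem coeff_toLaurent (p : MvPolynomial σ K) (c : σ →₀ ℕ) :
    (toLaurent K p).coeff (natExp σ c) = p.coeff c :=
  Finsupp.mapDomain_apply natExp_injective _ _

/-- Precomposition of exponents with a map, as an additive homomorphism. -/
def compExp (f : σ → A) : (A → ℤ) →+ (σ → ℤ) where
  toFun c := c ∘ f
  map_zero' := rfl
  map_add' _ _ := rfl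

variable (K) in
/-- The homomorphism of Laurent polynomial algebras given by precomposition of exponents. -/
def compHom (f : σ → A) : AddMonoidAlgebra K (A → ℤ) →ₐ[K] AddMonoidAlgebra K (σ → ℤ) :=
  AddMonoidAlgebra.mapDomainAlgHom K K (compExp f)

theorem compHom_single (f : σ → A) (c : A → ℤ) (k : K) :
    compHom K f (AddMonoidAlgebra.single c k) = AddMonoidAlgebra.single (c ∘ f) k :=
  AddMonoidAlgebra.mapDomain_single

theorem coeff_compHom_perm (π : Equiv.Perm σ) (F : AddMonoidAlgebra K (σ → ℤ)) (ε : σ → ℤ) :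
    (compHom K π F).coeff (ε ∘ π) = F.coeff ε :=
  Finsupp.mapDomain_apply (f := compExp π) π.surjective.injective_comp_right _ _

/-- The inverse appears because precomposing the unit exponent at `t` with `π` gives the unit
exponent at `π.symm t`. -/
theorem compHom_toLaurent (π : Equiv.Perm σ) (p : MvPolynomial σ K) :
    compHom K π (toLaurent K p) = toLaurent K (rename π.symm p) := by
  classical
  have : (compHom K π).comp (toLaurent K) = (toLaurent K).comp (rename π.symm) := by
    ext1 t
    simp only [AlgHom.comp_apply, rename_X]
    rw [X, X, toLaurent_monomial, toLaurent_monomial, compHom_single]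
    congr 1
    ext u
    simp [natExp_apply, Finsupp.single_apply, Equiv.symm_apply_eq]
  exact DFunLike.congr_fun this p

/-- The Laurent monomial all of whose exponents are `N`. -/
def constMonomial (K σ : Type*) [Field K] (N : ℤ) : AddMonoidAlgebra K (σ → ℤ) :=
  AddMonoidAlgebra.single (fun _ => N) 1

theorem constMonomial_add (N M : ℤ) :
    constMonomial K σ (N + M) = constMonomial K σ N * constMonomial K σ M := by
  rw [constMonomial, constMonomial, constMonomial, AddMonoidAlgebra.single_mul_single, one_mul]
  rfl

theorem constMonomial_zero : constMonomial K σ 0 = 1 := rfl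

theorem constMonomial_neg_mul (N : ℤ) : constMonomial K σ (-N) * constMonomial K σ N = 1 := by
  rw [← constMonomial_add, neg_add_cancel, constMonomial_zero]

theorem compHom_constMonomial (f : σ → A) (N : ℤ) :
    compHom K f (constMonomial K A N) = constMonomial K σ N := compHom_single _ _ _

variable [Fintype σ]

theorem exists_nonneg_add (c : σ → ℤ) : ∃ N : ℕ, ∀ t, 0 ≤ (N : ℤ) + c t := by
  refine ⟨∑ t, (c t).natAbs, fun t => ?_⟩
  have := Finset.single_le_sum (f := fun t => (c t).natAbs) (fun _ _ => Nat.zero_le _)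
    (Finset.mem_univ t)
  omega

theorem exists_natExp_eq {c : σ → ℤ} (hc : ∀ t, 0 ≤ c t) : ∃ d, natExp σ d = c :=
  ⟨Finsupp.equivFunOnFinite.symm fun t => (c t).toNat, by
    ext t
    simp [natExp_apply, hc t]⟩

theorem exists_toLaurent_eq_constMonomial (N : ℕ) :
    ∃ p, toLaurent K p = constMonomial K σ N := by
  obtain ⟨d, hd⟩ := exists_natExp_eq (σ := σ) (c := fun _ => (N : ℤ)) fun _ => by positivity
  exact ⟨monomial d 1, by rw [toLaurent_monomial, hd]; rfl⟩

/-- Denominators of Laurent polynomials can be cleared. -/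
theorem exists_constMonomial_mul_eq_toLaurent (F : AddMonoidAlgebra K (σ → ℤ)) :
    ∃ (N : ℕ) (p : MvPolynomial σ K), constMonomial K σ N * F = toLaurent K p := by
  induction F using AddMonoidAlgebra.induction_linear with
  | zero => exact ⟨0, 0, by simp⟩
  | single c k =>
    obtain ⟨N, hN⟩ := exists_nonneg_add c
    obtain ⟨d, hd⟩ := exists_natExp_eq (c := fun t => (N : ℤ) + c t) hN
    refine ⟨N, monomial d k, ?_⟩
    rw [toLaurent_monomial, hd, constMonomial, AddMonoidAlgebra.single_mul_single, one_mul]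
    rfl
  | add F G hF hG =>
    obtain ⟨N, p, hp⟩ := hF
    obtain ⟨M, q, hq⟩ := hG
    obtain ⟨u, hu⟩ := exists_toLaurent_eq_constMonomial (K := K) (σ := σ) N
    obtain ⟨v, hv⟩ := exists_toLaurent_eq_constMonomial (K := K) (σ := σ) M
    -- Common denominator: `u` and `v` are the polynomial forms of the two constant monomials.
    refine ⟨N + M, v * p + u * q, ?_⟩
    rw [map_add, map_mul, map_mul, ← hp, ← hq, hu, hv, Nat.cast_add, constMonomial_add]
    ring

end Laurent

/-! ### Invariant Laurent polynomials of a Young subgroup. -/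

section Invariants

variable {σ A : Type*} {K : Type*} [Field K] [LinearOrder σ] [DecidableEq A] {b : σ → A}

/-- The last elements of the blocks of `b`. -/
def IsLast (b : σ → A) (t : σ) : Prop := ∀ u, b u = b t → u ≤ t

open Classical in
variable (K b) in
/-- The inclusion of the polynomial algebra into the source of `laurentHom`, where the
indeterminates of the last elements are inverted. -/
def sourceHom : MvPolynomial σ K →ₐ[K]
    MvPolynomial {t // ¬ IsLast b t} (AddMonoidAlgebra K (A → ℤ)) :=
  aeval fun t => if h : IsLast b t then C (AddMonoidAlgebra.single (Pi.single (b t) 1) 1)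
    else X ⟨t, h⟩

theorem sourceHom_X_of_isLast {t : σ} (h : IsLast b t) :
    sourceHom K b (X t) = C (AddMonoidAlgebra.single (Pi.single (b t) 1) 1) := by
  simp [sourceHom, h]

theorem sourceHom_X_of_not_isLast (t : {t // ¬ IsLast b t}) :
    sourceHom K b (X t) = X t := by
  simp [sourceHom, t.2]

theorem sourceHom_C (k : K) :
    sourceHom K b (C k) = C (AddMonoidAlgebra.single 0 k) :=
  (sourceHom K b).commutes k

variable [Fintype σ]

variable (K b) in
/-- The homomorphism that sends the coefficients to Laurent polynomials in the products of the
variables over a block, and the indeterminates to the other block-wise elementary symmetric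
polynomials. -/
def laurentHom : MvPolynomial {t // ¬ IsLast b t} (AddMonoidAlgebra K (A → ℤ)) →ₐ[K]
    AddMonoidAlgebra K (σ → ℤ) :=
  aevalTower (compHom K b) fun t => toLaurent K (elem K b t)

theorem laurentHom_C (x : AddMonoidAlgebra K (A → ℤ)) :
    laurentHom K b (C x) = compHom K b x := aevalTower_C _ _ _

theorem laurentHom_X (t : {t // ¬ IsLast b t}) :
    laurentHom K b (X t) = toLaurent K (elem K b t) := aevalTower_X _ _ _

theorem compHom_laurentHom {π : Equiv.Perm σ} (hπ : b ∘ π = b)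
    (x : MvPolynomial {t // ¬ IsLast b t} (AddMonoidAlgebra K (A → ℤ))) :
    compHom K π (laurentHom K b x) = laurentHom K b x := by
  induction x using MvPolynomial.induction_on with
  | C a =>
    rw [laurentHom_C]
    induction a using AddMonoidAlgebra.induction_linear with
    | zero => simp
    | single c k => rw [compHom_single, compHom_single, Function.comp_assoc, hπ]
    | add F G hF hG => rw [map_add, map_add, hF, hG]
  | add p q hp hq => rw [map_add, map_add, hp, hq]
  | mul_X p t hp =>
    rw [map_mul, map_mul, hp, laurentHom_X, compHom_toLaurent, rename_elem _ (comp_symm_eq hπ)]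

/-- This commuting square transfers the polynomial theorem to `laurentHom`. On the last index of a
block both paths give the product of the block's variables. -/
theorem laurentHom_sourceHom (p : MvPolynomial σ K) :
    laurentHom K b (sourceHom K b p) = toLaurent K (elemHom K b p) := by
  have : (laurentHom K b).comp (sourceHom K b) = (toLaurent K).comp (elemHom K b) := by
    ext1 t
    simp only [AlgHom.comp_apply]
    have hX : elemHom K b (X t) = elem K b t := aeval_X _ _
    by_cases h : IsLast b t
    · rw [sourceHom_X_of_isLast h, hX, elem_of_isTop h, toLaurent_monomial, laurentHom_C,
        compHom_single]
      congr 1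
      ext u
      simp [natExp_apply, ind_apply, mem_block, Pi.single_apply]
    · rw [sourceHom_X_of_not_isLast ⟨t, h⟩, hX, laurentHom_X]
  exact DFunLike.congr_fun this p

/-- The image of `laurentHom` consists of the invariants of the Young subgroup. -/
theorem exists_laurentHom_eq_iff (F : AddMonoidAlgebra K (σ → ℤ)) :
    (∃ x, laurentHom K b x = F) ↔
      ∀ π : Equiv.Perm σ, b ∘ π = b → ∀ ε, F.coeff (ε ∘ π) = F.coeff ε := by
  constructor
  · rintro ⟨x, rfl⟩ π hπ ε
    rw [← coeff_compHom_perm π _ ε, compHom_laurentHom hπ]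
  · intro hF
    obtain ⟨N, q, hq⟩ := exists_constMonomial_mul_eq_toLaurent F
    have hcoeff : ∀ c, q.coeff c = F.coeff fun t => -N + c t := fun c => by
      rw [← coeff_toLaurent, ← hq, constMonomial, AddMonoidAlgebra.coeff_single_mul_apply, one_mul]
      rfl
    -- A constant shift of exponents commutes with permutations, so `q` inherits the invariance of
    -- `F`.
    obtain ⟨p, rfl⟩ := exists_elemHom_eq (b := b) q fun π hπ => by
      ext c
      obtain ⟨d, rfl⟩ := Finsupp.mapDomain_surjective π.surjective c
      rw [coeff_rename_mapDomain _ π.injective, hcoeff, hcoeff,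
        ← hF π hπ fun t => -N + d.mapDomain π t]
      congr 1
      ext t
      simp
    -- The denominator is a power of the product of all variables. It comes from a constant exponent
    -- on the blocks, so it is already invertible in the source.
    refine ⟨C (constMonomial K A (-N)) * sourceHom K b p, ?_⟩
    rw [map_mul, laurentHom_sourceHom, ← hq, laurentHom_C, compHom_constMonomial, ← mul_assoc,
      constMonomial_neg_mul, one_mul]

theorem exists_isLast (hb : Function.Surjective b) (a : A) : ∃ t, b t = a ∧ IsLast b t := by
  obtain ⟨u, rfl⟩ := hb a
  have hne : (block b u).Nonempty := ⟨u, mem_block.2 rfl⟩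
  have h := mem_block.1 (Finset.max'_mem _ hne)
  exact ⟨(block b u).max' hne, h, fun v hv => Finset.le_max' _ _ (mem_block.2 (hv.trans h))⟩

variable [Fintype A]

/-- Surjectivity of `b` gives every `a` a last index `ℓ a`, whose variable maps to the Laurent
indeterminate of `a`. -/
theorem exists_sourceHom_eq_C_single (hb : Function.Surjective b) {c : A → ℤ}
    (hc : ∀ a, 0 ≤ c a) (k : K) :
    ∃ p, sourceHom K b p = C (AddMonoidAlgebra.single c k) := by
  choose ℓ hℓ hlast using exists_isLast hb
  obtain ⟨d, rfl⟩ := exists_natExp_eq hc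
  refine ⟨C k * ∏ a, X (ℓ a) ^ d a, ?_⟩
  rw [map_mul, map_prod, sourceHom_C]
  simp_rw [map_pow, sourceHom_X_of_isLast (hlast _), hℓ, ← map_pow]
  rw [← map_prod, ← map_mul]
  congr 1
  have h : ∀ a, (AddMonoidAlgebra.single (Pi.single a 1 : A → ℤ) (1 : K)) ^ d a =
      AddMonoidAlgebra.single (Pi.single a (d a : ℤ)) 1 := fun a => by
    rw [AddMonoidAlgebra.single_pow, one_pow, ← Pi.single_smul]
    simp
  simp_rw [h]
  rw [AddMonoidAlgebra.prod_single, AddMonoidAlgebra.single_mul_single]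
  simp [Finset.univ_sum_single]
  rfl

theorem exists_sourceHom_eq_constMonomial (hb : Function.Surjective b) (N : ℕ) :
    ∃ p, sourceHom K b p = C (constMonomial K A N) :=
  exists_sourceHom_eq_C_single hb (fun _ => Nat.cast_nonneg N) 1

/-- Denominators in the source of `laurentHom` can be cleared. -/
theorem exists_constMonomial_mul_eq_sourceHom (hb : Function.Surjective b)
    (x : MvPolynomial {t // ¬ IsLast b t} (AddMonoidAlgebra K (A → ℤ))) :
    ∃ (N : ℕ) (p : MvPolynomial σ K), C (constMonomial K A N) * x = sourceHom K b p := by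
  have hadd : ∀ x y : MvPolynomial {t // ¬ IsLast b t} (AddMonoidAlgebra K (A → ℤ)),
      (∃ (N : ℕ) (p : MvPolynomial σ K), C (constMonomial K A N) * x = sourceHom K b p) →
      (∃ (N : ℕ) (p : MvPolynomial σ K), C (constMonomial K A N) * y = sourceHom K b p) →
      ∃ (N : ℕ) (p : MvPolynomial σ K),
        C (constMonomial K A N) * (x + y) = sourceHom K b p := by
    rintro x y ⟨N, p, hp⟩ ⟨M, q, hq⟩
    obtain ⟨u, hu⟩ := exists_sourceHom_eq_constMonomial (K := K) hb N
    obtain ⟨v, hv⟩ := exists_sourceHom_eq_constMonomial (K := K) hb M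
    refine ⟨N + M, v * p + u * q, ?_⟩
    rw [map_add, map_mul, map_mul, ← hp, ← hq, hu, hv, Nat.cast_add, constMonomial_add, map_mul]
    ring
  induction x using MvPolynomial.induction_on with
  | C a =>
    induction a using AddMonoidAlgebra.induction_linear with
    | zero => exact ⟨0, 0, by simp⟩
    | single c k =>
      obtain ⟨N, hN⟩ := exists_nonneg_add c
      obtain ⟨p, hp⟩ := exists_sourceHom_eq_C_single hb hN k
      refine ⟨N, p, ?_⟩
      rw [hp, constMonomial, ← map_mul, AddMonoidAlgebra.single_mul_single, one_mul]
      rfl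
    | add F G hF hG =>
      rw [map_add]
      exact hadd _ _ hF hG
  | add p q hp hq => exact hadd _ _ hp hq
  | mul_X p t hp =>
    obtain ⟨N, q, hq⟩ := hp
    exact ⟨N, q * X t.1, by rw [map_mul (sourceHom K b), sourceHom_X_of_not_isLast, ← hq, mul_assoc]⟩

/-- Up to a unit, every element of the source comes from a polynomial, so injectivity reduces to
that of `elemHom`. -/
theorem laurentHom_injective (hb : Function.Surjective b) :
    Function.Injective (laurentHom K b) := by
  rw [injective_iff_map_eq_zero]
  intro x hx
  obtain ⟨N, p, hp⟩ := exists_constMonomial_mul_eq_sourceHom hb x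
  have h : toLaurent K (elemHom K b p) = 0 := by
    rw [← laurentHom_sourceHom, ← hp, map_mul, hx, mul_zero]
  have hp0 : p = 0 := elemHom_injective (toLaurent_injective (by rw [h, map_zero, map_zero]))
  rw [hp0, map_zero] at hp
  rw [← one_mul x, ← map_one C, ← constMonomial_neg_mul (N : ℤ), map_mul, mul_assoc, hp, mul_zero]

theorem card_isLast [DecidablePred (IsLast b)] (hb : Function.Surjective b) :
    Fintype.card {t // ¬ IsLast b t} = Fintype.card σ - Fintype.card A := by
  rw [Fintype.card_subtype_compl]
  congr 1
  refine Fintype.card_congr (Equiv.ofBijective (fun t => b t.1) ⟨?_, ?_⟩)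
  · rintro ⟨t, ht⟩ ⟨u, hu⟩ h
    exact Subtype.ext (le_antisymm (hu t h) (ht u h.symm))
  · intro a
    obtain ⟨t, rfl, ht⟩ := exists_isLast hb a
    exact ⟨⟨t, ht⟩, rfl⟩

end Invariants

end

end BlockSymmetric

namespace AffineSchur

noncomputable section

/-! ### Orbits of the pairs `(i, i + nε)`. -/

section

variable {K : Type*} [Field K] {n : ℕ} {r : ℕ} {i : Fin r → ℤ}

variable (n i) in
/-- The multi-index `i + nε`. -/
def shift (ε : Fin r → ℤ) : Fin r → ℤ := fun t => i t + n * ε t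

theorem shift_zero : shift n i 0 = i := by
  ext t
  simp [shift]

theorem act_one_shift (η ε : Fin r → ℤ) : act n 1 η (shift n i ε) = shift n i (ε + η) := by
  ext t
  simp [act, shift]
  ring

theorem orb_shift_shift (η ε : Fin r → ℤ) :
    orb n (shift n i η) (shift n i ε) = orb n i (shift n i (-η + ε)) := by
  rw [← orb_act 1 (-η) (shift n i η), act_one_shift, act_one_shift, add_neg_cancel, shift_zero,
    add_comm]

/-- The group element relating the two pairs fixes `i`, so its permutation `σ` gives `s = i + n(ε ∘
σ)`. -/
theorem exists_eq_shift {s ε : Fin r → ℤ} (h : orb n i s = orb n i (shift n i ε)) :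
    ∃ η, s = shift n i η := by
  obtain ⟨σ, δ, h1, h2⟩ := orb_eq_iff.1 h.symm
  refine ⟨ε ∘ σ, ?_⟩
  rw [h2]
  conv_rhs => rw [h1]
  ext t
  simp only [act, shift, Function.comp_apply]
  ring

theorem numNonzero_eq_card_image (hi : ∀ t, 1 ≤ i t ∧ i t ≤ (n : ℤ)) :
    numNonzero n i = (Finset.univ.image i).card := by
  unfold numNonzero
  congr 1
  ext s
  simp only [weight, ne_eq, Finset.card_eq_zero, Finset.mem_filter, Finset.mem_Icc,
    Finset.mem_image, Finset.mem_univ, true_and, exists_const, Finset.filter_eq_empty_iff,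
    not_forall, not_not]
  constructor
  · rintro ⟨_, t, ht⟩
    exact ⟨t, ht⟩
  · rintro ⟨t, rfl⟩
    exact ⟨hi t, t, rfl⟩

/-- Relabelling the values of `i` makes the coloring surjective, with the same blocks and a color
set of the size of the Laurent rank. -/
theorem exists_blockMap (hi : ∀ t, 1 ≤ i t ∧ i t ≤ (n : ℤ)) :
    ∃ b : Fin r → Fin (numNonzero n i), Function.Surjective b ∧ ∀ t u, b t = b u ↔ i t = i u := by
  let e := (Finset.univ.image i).equivFinOfCardEq (numNonzero_eq_card_image hi).symm
  refine ⟨fun t => e ⟨i t, Finset.mem_image_of_mem _ (Finset.mem_univ t)⟩, fun a => ?_,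
    fun t u => by simp⟩
  obtain ⟨⟨s, hs⟩, rfl⟩ := e.surjective a
  obtain ⟨t, _, rfl⟩ := Finset.mem_image.1 hs
  exact ⟨t, rfl⟩

variable [NeZero n]

theorem shift_injective : Function.Injective (shift n i) := by
  intro ε η h
  ext t
  have hn : (n : ℤ) ≠ 0 := by exact_mod_cast NeZero.ne n
  exact mul_left_cancel₀ hn (add_left_cancel (congrFun h t))

theorem orb_shift_eq_iff (hi : ∀ t, 1 ≤ i t ∧ i t ≤ (n : ℤ)) {ε η : Fin r → ℤ} :
    orb n i (shift n i ε) = orb n i (shift n i η) ↔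
      ∃ π : Equiv.Perm (Fin r), i ∘ π = i ∧ η = ε ∘ π := by
  constructor
  · intro h
    obtain ⟨σ, δ, h1, h2⟩ := orb_eq_iff.1 h
    -- Here `n * δ t` is a difference of two entries in `1, …, n`, hence less than `n` in absolute
    -- value.
    have hδ : δ = 0 := by
      ext t
      have h3 := congrFun h1 t
      simp only [act] at h3
      have h4 := hi t
      have h5 := hi (σ t)
      by_contra hne
      rcases lt_or_gt_of_ne hne with hlt | hgt
      · nlinarith [show δ t ≤ -1 by simp at hlt; omega]
      · nlinarith [show 1 ≤ δ t by simp at hgt; omega]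
    subst hδ
    have h6 : i ∘ σ = i := by
      conv_rhs => rw [h1]
      ext t
      simp [act]
    refine ⟨σ, h6, shift_injective (n := n) (i := i) ?_⟩
    rw [h2]
    ext t
    simp [act, shift, ← congrFun h6 t]
  · rintro ⟨π, h1, rfl⟩
    refine orb_eq_iff.2 ⟨π, 0, ?_, ?_⟩
    · conv_lhs => rw [← h1]
      ext t
      simp [act]
    · ext t
      simp [act, shift, ← congrFun h1 t]

/-! ### The embedding of `B K n i` into Laurent polynomials and its image. -/

theorem exists_orb_eq_of_mem_B {x : Centralizer K n i} (hx : x ∈ B K n i) {o : Orb n r}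
    (ho : x.1 o ≠ 0) : ∃ ε, o = orb n i (shift n i ε) := by
  change x ∈ Submodule.span K (Set.range (xiShift K n i)) at hx
  by_contra hne
  refine ho ?_
  induction hx using Submodule.span_induction with
  | mem x hx =>
    classical
    obtain ⟨ε, rfl⟩ := hx
    change xi K n i (shift n i ε) o = 0
    rw [xi_apply, if_neg fun h => hne ⟨ε, h.symm⟩]
  | zero => rfl
  | add x y _ _ hx hy =>
    change (x.1 + y.1) o = 0
    rw [add_apply]
    by_cases h1 : x.1 o = 0
    · by_cases h2 : y.1 o = 0
      · rw [h1, h2, add_zero]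
      · exact absurd (hy h2) h2
    · exact absurd (hx h1) h1
  | smul c x _ hx =>
    change (c • x.1) o = 0
    rw [smul_apply]
    by_cases h1 : x.1 o = 0
    · rw [h1, mul_zero]
    · exact absurd (hx h1) h1

variable (i) in
theorem finite_shift_support (f : Schur K n r) :
    {ε : Fin r → ℤ | f (orb n i (shift n i ε)) ≠ 0}.Finite := by
  have h : {s : Fin r → ℤ | f (orb n i s) ≠ 0} ⊆
      ⋃ b ∈ Finsupp.support (f : Orb n r →₀ K), {s | orb n i s = b} := by
    intro s hs
    simp only [Set.mem_iUnion]
    exact ⟨orb n i s, Finsupp.mem_support_iff.2 hs, rfl⟩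
  exact ((Set.Finite.biUnion (Finset.finite_toSet _) fun b _ => finite_row b i).subset h).preimage
    shift_injective.injOn

variable (i) in
/-- The Laurent polynomial whose coefficients are the values of `f` at the orbits of the
pairs `(i, i + nε)`. -/
def shiftCoeff (f : Schur K n r) : AddMonoidAlgebra K (Fin r → ℤ) :=
  .ofCoeff (Finsupp.ofSupportFinite (fun ε => f (orb n i (shift n i ε)))
    (finite_shift_support i f))

theorem coeff_shiftCoeff (f : Schur K n r) (ε : Fin r → ℤ) :
    (shiftCoeff i f).coeff ε = f (orb n i (shift n i ε)) := rfl

/-- The support of `x` restricts the intermediate index to `i + nη`, and `orb_shift_shift` turns the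
other factor into the coefficient of `g` at `-η + ε`. -/
theorem shiftCoeff_mul {x : Centralizer K n i} (hx : x ∈ B K n i) (g : Schur K n r) :
    shiftCoeff i (x.1 * g) = shiftCoeff i x.1 * shiftCoeff i g := by
  classical
  ext ε
  rw [coeff_shiftCoeff, AddMonoidAlgebra.coeff_mul_apply_left, Finsupp.sum,
    mul_apply_of_subset _ _ _ _ ((shiftCoeff i x.1).coeff.support.image (shift n i)),
    Finset.sum_image shift_injective.injOn]
  · refine Finset.sum_congr rfl fun η _ => ?_
    rw [orb_shift_shift]
    rfl
  · intro s hs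
    obtain ⟨η, h⟩ := exists_orb_eq_of_mem_B hx (left_ne_zero_of_mul hs)
    obtain ⟨θ, rfl⟩ := exists_eq_shift h
    exact Finset.mem_image_of_mem _ (Finsupp.mem_support_iff.2 (left_ne_zero_of_mul hs))

variable (K n i) in
/-- The embedding of `B_i` into the algebra of Laurent polynomials in `r` indeterminates. -/
def laurentEmbedding : B K n i →ₐ[K] AddMonoidAlgebra K (Fin r → ℤ) :=
  AlgHom.ofLinearMap
    { toFun := fun x => shiftCoeff i x.1.1
      map_add' := fun x y => by
        ext ε
        exact add_apply x.1.1 y.1.1 _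
      map_smul' := fun c x => by
        ext ε
        exact smul_apply c x.1.1 _ }
    (by
      classical
      ext ε
      change xi K n i i (orb n i (shift n i ε)) = _
      rw [xi_apply, AddMonoidAlgebra.one_def, AddMonoidAlgebra.coeff_single, Finsupp.single_apply]
      refine if_congr ⟨fun h => ?_, fun h => ?_⟩ rfl rfl
      · obtain ⟨σ, δ, h1, h2⟩ := orb_eq_iff.1 h
        exact shift_injective (n := n) (i := i) (by rw [shift_zero, h2, ← h1])
      · rw [← h, shift_zero])
    fun x y => shiftCoeff_mul x.2 y.1.1

theorem coeff_laurentEmbedding (x : B K n i) (ε : Fin r → ℤ) :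
    (laurentEmbedding K n i x).coeff ε = x.1.1 (orb n i (shift n i ε)) := rfl

theorem laurentEmbedding_injective : Function.Injective (laurentEmbedding K n i) := by
  rw [injective_iff_map_eq_zero]
  intro x hx
  refine Subtype.ext (Subtype.ext (schur_ext fun p q => ?_))
  by_contra h
  obtain ⟨ε, hε⟩ := exists_orb_eq_of_mem_B x.2 h
  rw [hε] at h
  rw [← coeff_laurentEmbedding, hx] at h
  exact h rfl

theorem laurentEmbedding_xiShift_coeff [DecidableEq (Orb n r)] (ε η : Fin r → ℤ) :
    (laurentEmbedding K n i ⟨xiShift K n i ε, Submodule.subset_span ⟨ε, rfl⟩⟩).coeff η =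
      if orb n i (shift n i ε) = orb n i (shift n i η) then 1 else 0 := by
  rw [coeff_laurentEmbedding]
  change xi K n i (shift n i ε) _ = _
  rw [xi_apply]
  congr

/-- The image of `B_i` in the Laurent polynomials consists of the invariants of the
stabilizer of `i`. -/
theorem exists_laurentEmbedding_eq_iff (hi : ∀ t, 1 ≤ i t ∧ i t ≤ (n : ℤ))
    (F : AddMonoidAlgebra K (Fin r → ℤ)) :
    (∃ x, laurentEmbedding K n i x = F) ↔
      ∀ π : Equiv.Perm (Fin r), i ∘ π = i → ∀ ε, F.coeff (ε ∘ π) = F.coeff ε := by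
  classical
  constructor
  · rintro ⟨x, rfl⟩ π hπ ε
    rw [coeff_laurentEmbedding, coeff_laurentEmbedding,
      (orb_shift_eq_iff hi (ε := ε)).2 ⟨π, hπ, rfl⟩]
  · intro hF
    have hF' : ∀ ε η, orb n i (shift n i ε) = orb n i (shift n i η) → F.coeff ε = F.coeff η := by
      intro ε η h
      obtain ⟨π, hπ, rfl⟩ := (orb_shift_eq_iff hi).1 h
      exact (hF π hπ ε).symm
    -- Each `xiShift` maps to the sum over a whole stabilizer orbit, so `F` is rebuilt using one
    -- representative exponent per orbit.
    let O : Finset (Orb n r) := F.coeff.support.image fun ε => orb n i (shift n i ε)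
    have hO : ∀ o ∈ O, ∃ ε, orb n i (shift n i ε) = o := by
      intro o ho
      obtain ⟨ε, _, h⟩ := Finset.mem_image.1 ho
      exact ⟨ε, h⟩
    choose! e he using hO
    refine ⟨∑ o ∈ O, F.coeff (e o) • ⟨xiShift K n i (e o), Submodule.subset_span ⟨e o, rfl⟩⟩, ?_⟩
    ext η
    rw [map_sum, AddMonoidAlgebra.coeff_sum, Finsupp.finsetSum_apply]
    simp_rw [map_smul, AddMonoidAlgebra.coeff_smul_apply, laurentEmbedding_xiShift_coeff]
    rw [Finset.sum_congr rfl fun o ho => by rw [he o ho]]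
    simp only [smul_eq_mul, mul_ite, mul_one, mul_zero, Finset.sum_ite_eq']
    split_ifs with h
    · exact hF' _ _ (he _ h)
    · by_contra h0
      exact h (Finset.mem_image_of_mem _ (Finsupp.mem_support_iff.2 (Ne.symm h0)))

/-! ### The isomorphism and the Noetherian property. -/

/-- `B_i` is a polynomial algebra over a Laurent polynomial algebra. -/
theorem nonempty_B_algEquiv (hi : ∀ t, 1 ≤ i t ∧ i t ≤ (n : ℤ)) :
    Nonempty (B K n i ≃ₐ[K] MvPolynomial (Fin (r - numNonzero n i))
      (LaurentAlgebra K (numNonzero n i))) := by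
  classical
  obtain ⟨b, hb, hbi⟩ := exists_blockMap hi
  have hperm : ∀ π : Equiv.Perm (Fin r), b ∘ π = b ↔ i ∘ π = i := fun π => by
    simp [funext_iff, hbi]
  -- Since `b` and `i` have the same stabilizer, both injections have the same ring of invariants as
  -- image.
  have hrange : (laurentEmbedding K n i).range = (BlockSymmetric.laurentHom K b).range := by
    ext F
    rw [AlgHom.mem_range, AlgHom.mem_range, exists_laurentEmbedding_eq_iff hi,
      BlockSymmetric.exists_laurentHom_eq_iff]
    simp_rw [hperm]
  have hcard : Fintype.card {t // ¬ BlockSymmetric.IsLast b t} =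
      Fintype.card (Fin (r - numNonzero n i)) := by
    rw [BlockSymmetric.card_isLast hb, Fintype.card_fin, Fintype.card_fin, Fintype.card_fin]
  exact ⟨((AlgEquiv.ofInjective _ laurentEmbedding_injective).trans
    (Subalgebra.equivOfEq _ _ hrange)).trans
    ((AlgEquiv.ofInjective _ (BlockSymmetric.laurentHom_injective hb)).symm.trans
      ((MvPolynomial.renameEquiv (LaurentAlgebra K (numNonzero n i))
        (Fintype.equivOfCardEq hcard)).restrictScalars K))⟩

/-- The group `ℤ^m` is finitely generated as a monoid too, so its group algebra is of finite type
over a field. -/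
instance (m : ℕ) : IsNoetherianRing (LaurentAlgebra K m) :=
  have : AddMonoid.FG (Fin m → ℤ) := AddGroup.fg_iff_addMonoid_fg.1 inferInstance
  Algebra.FiniteType.isNoetherianRing K _

end

end

end AffineSchur

theorem propositionP (K : Type*) [Field K] [Infinite K] (n r : ℕ) [NeZero n]
    (i : Fin r → ℤ) (hi : ∀ t, 1 ≤ i t ∧ i t ≤ (n : ℤ)) :
    (∀ x y : AffineSchur.B K n i, x * y = y * x) ∧
    Nonempty (AffineSchur.B K n i ≃ₐ[K]
      MvPolynomial (Fin (r - AffineSchur.numNonzero n i))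
        (AffineSchur.LaurentAlgebra K (AffineSchur.numNonzero n i))) ∧
    IsNoetherianRing (AffineSchur.B K n i) := by
  obtain ⟨e⟩ := AffineSchur.nonempty_B_algEquiv (K := K) hi
  refine ⟨fun x y => e.injective ?_, ⟨e⟩, isNoetherianRing_of_ringEquiv _ e.symm.toRingEquiv⟩
  rw [map_mul, map_mul, mul_comm]
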